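/- Let $n \geq 0$ be an integer. The singular braid group $SG_n$ is the group with generators $\sigma_1,\dots,\sigma_{n-1}$ and (if $n\ge 2$) $\tau_1$, subject to the following relations, each imposed whenever all the generators that occur in it exist: \begin{align*} \sigma_i\sigma_{i+1}\sigma_i &= \sigma_{i+1}\sigma_i\sigma_{i+1}, \qquad \sigma_i\sigma_j=\sigma_j\sigma_i \quad (j>i+1),\\ \sigma_2\sigma_1^2\sigma_2\,\tau_1 &= \tau_1\,\sigma_2\sigma_1^2\sigma_2,\\ \sigma_i\tau_1&=\tau_1\sigma_i \quad (i\neq 2),\\ \sigma_2\sigma_3\sigma_1\sigma_2\,\tau_1\,\sigma_2\sigma_3\sigma_1\sigma_2\,\tau_1 &= \tau_1\,\sigma_2\sigma_3\sigma_1\sigma_2\,\tau_1\,\sigma_2\sigma_3\sigma_1\sigma_2 \quad (n>3). \end{align*} (For $n\le 1$ this group is trivial.) Let $SGP_n$, the pure singular braid group, be the kernel of the homomorphism $SG_n\to \mathrm{Sym}(\{1,\dots,n\})$ that sends $\sigma_i$ to the transposition $(i\;\,i+1)$ for every $i$ and $\tau_1$ to $(1\;\,2)$. Then $$H_1(SGP_n,\mathbb{Z})\cong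 \mathbb{Z}^{n(n-1)},$$ where $\mathbb{Z}$ is the trivial $SGP_n$-module; that is, the first integral homology group of $SGP_n$ is free abelian of rank $n(n-1)$. -/

import Mathlib

/-- Generators of the singular braid group on `n` strands. `Gen.σ i` with `i = 0, …, n - 2` is the
elementary braid usually written `σ_{i+1}`, and `Gen.τ₁` (present only for `n ≥ 2`) is the
elementary singular braid `τ_1` on the first two strands. -/
inductive SingularBraid.Gen (n : ℕ) : Type
  | σ (i : Fin (n - 1)) : SingularBraid.Gen n
  | τ₁ (hn : 2 ≤ n) : SingularBraid.Gen n

namespace SingularBraid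

/-- The letter `σ_{i+1}` in the free group on the generators. -/
def s {n : ℕ} (i : Fin (n - 1)) : FreeGroup (Gen n) := FreeGroup.of (Gen.σ i)

/-- The letter `τ_1` in the free group on the generators. -/
def t {n : ℕ} (hn : 2 ≤ n) : FreeGroup (Gen n) := FreeGroup.of (Gen.τ₁ hn)

/-- The defining relations `u = v` of the singular braid monoid. Indices are shifted by one: the
value `0` of an index stands for `σ_1`, the value `1` for `σ_2`, the value `2` for `σ_3`. -/
inductive Rel (n : ℕ) : FreeGroup (Gen n) → FreeGroup (Gen n) → Prop
  | braid (i j : Fin (n - 1)) (hij : (i : ℕ) + 1 = j) :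
      Rel n (s i * s j * s i) (s j * s i * s j)
  | far (i j : Fin (n - 1)) (hij : (i : ℕ) + 1 < j) :
      Rel n (s i * s j) (s j * s i)
  | tau_loop (hn : 2 ≤ n) (i j : Fin (n - 1)) (hi : (i : ℕ) = 0) (hj : (j : ℕ) = 1) :
      Rel n (s j * s i ^ 2 * s j * t hn) (t hn * s j * s i ^ 2 * s j)
  | tau_sigma (hn : 2 ≤ n) (i : Fin (n - 1)) (hi : (i : ℕ) ≠ 1) :
      Rel n (s i * t hn) (t hn * s i)
  | tau_tau (hn : 2 ≤ n) (i j k : Fin (n - 1))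
      (hi : (i : ℕ) = 0) (hj : (j : ℕ) = 1) (hk : (k : ℕ) = 2) :
      Rel n (s j * s k * s i * s j * t hn * s j * s k * s i * s j * t hn)
        (t hn * s j * s k * s i * s j * t hn * s j * s k * s i * s j)

/-- The relators `u v⁻¹` given by the relations `u = v`. -/
def relators (n : ℕ) : Set (FreeGroup (Gen n)) :=
  {w | ∃ u v, Rel n u v ∧ w = u * v⁻¹}

/-- The singular braid group `SG_n`: the presentation of the singular braid monoid, read as a
group presentation. -/
abbrev SG (n : ℕ) : Type := PresentedGroup (relators n)

/-- The adjacent transposition `(i+1, i+2)` of `{1, …, n}`, in 0-based indexing `(i, i+1)`. -/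
def adjSwap {n : ℕ} (i : Fin (n - 1)) : Equiv.Perm (Fin n) :=
  Equiv.swap ⟨i, by omega⟩ ⟨(i : ℕ) + 1, by omega⟩

/-- Both `σ_i` and `τ_i` induce the transposition `(i, i+1)` of the strands. -/
def genPerm {n : ℕ} : Gen n → Equiv.Perm (Fin n)
  | Gen.σ i => adjSwap i
  | Gen.τ₁ hn => adjSwap ⟨0, by omega⟩

theorem adjSwap_mul_self {n : ℕ} (i : Fin (n - 1)) : adjSwap i * adjSwap i = 1 := by
  simp [adjSwap]

theorem adjSwap_braid {n : ℕ} (i j : Fin (n - 1)) (hij : (i : ℕ) + 1 = j) :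
    adjSwap i * adjSwap j * adjSwap i = adjSwap j * adjSwap i * adjSwap j := by
  ext x
  simp only [adjSwap, Equiv.Perm.mul_apply, Equiv.swap_apply_def, Fin.ext_iff]
  grind

theorem adjSwap_far {n : ℕ} (i j : Fin (n - 1)) (hij : (i : ℕ) + 1 < j) :
    adjSwap i * adjSwap j = adjSwap j * adjSwap i := by
  ext x
  simp only [adjSwap, Equiv.Perm.mul_apply, Equiv.swap_apply_def, Fin.ext_iff]
  grind

theorem genPerm_rel {n : ℕ} {u v : FreeGroup (Gen n)} (h : Rel n u v) :
    FreeGroup.lift genPerm u = FreeGroup.lift genPerm v := by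
  cases h with
  | braid i j hij => simpa [s, genPerm] using adjSwap_braid i j hij
  | far i j hij => simpa [s, genPerm] using adjSwap_far i j hij
  | tau_loop hn i j hi hj =>
    have h1 : adjSwap j * adjSwap i ^ 2 * adjSwap j = 1 := by
      rw [pow_two, adjSwap_mul_self, mul_one, adjSwap_mul_self]
    simp only [s, t, genPerm, map_mul, map_pow, FreeGroup.lift_apply_of]
    rw [h1, one_mul, mul_assoc, mul_assoc, ← mul_assoc (adjSwap j), h1, mul_one]
  | tau_sigma hn i hi =>
    simp only [s, t, genPerm, map_mul, FreeGroup.lift_apply_of]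
    rcases Nat.lt_or_ge (i : ℕ) 1 with h0 | h1
    · have : i = ⟨0, by omega⟩ := Fin.ext (by simp; omega)
      rw [this]
    · exact (adjSwap_far _ _ (by simp; omega)).symm
  | tau_tau hn i j k hi hj hk =>
    have hi0 : (⟨0, by omega⟩ : Fin (n - 1)) = i := Fin.ext hi.symm
    simp only [s, t, genPerm, map_mul, FreeGroup.lift_apply_of, hi0]
    have a := adjSwap_braid i j (by omega)
    have b := adjSwap_braid j k (by omega)
    have c := adjSwap_far i k (by omega)
    have d := adjSwap_mul_self i
    generalize adjSwap i = x at *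
    generalize adjSwap j = y at *
    generalize adjSwap k = z at *
    have e : y * z * x * y * x = z * (y * z * x * y) := by
      calc y * z * x * y * x = y * z * (x * y * x) := by group
        _ = y * z * y * x * y := by rw [a]; group
        _ = z * (y * z * x * y) := by rw [b]; group
    have f : x * (y * z * x * y) = y * z * x * y * z := by
      calc x * (y * z * x * y) = x * y * (z * x) * y := by group
        _ = (x * y * x) * z * y := by rw [← c]; group
        _ = y * x * (y * z * y) := by rw [a]; group
        _ = y * (x * z) * y * z := by rw [b]; group
        _ = y * z * x * y * z := by rw [c]; group
    calc y * z * x * y * x * y * z * x * y * x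
        = (y * z * x * y * x) * (y * z * x * y) * x := by group
      _ = z * (y * z * x * y) * (y * z * x * y) * x := by rw [e]
      _ = z * (y * z * x * y) * (y * z * x * y * x) := by group
      _ = z * ((y * z * x * y) * z) * (y * z * x * y) := by rw [e]; group
      _ = z * x * (y * z * x * y) * (y * z * x * y) := by rw [← f]; group
      _ = x * (z * (y * z * x * y)) * (y * z * x * y) := by rw [← c]; group
      _ = x * y * z * x * y * x * y * z * x * y := by rw [← e]; group

theorem genPerm_relators {n : ℕ} :
    ∀ r ∈ relators n, FreeGroup.lift (genPerm (n := n)) r = 1 := by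
  rintro r ⟨u, v, huv, rfl⟩
  rw [map_mul, map_inv, genPerm_rel huv, mul_inv_cancel]

/-- The natural homomorphism `SG_n → Σ_n` onto the symmetric group. -/
def toPerm (n : ℕ) : SG n →* Equiv.Perm (Fin n) :=
  PresentedGroup.toGroup genPerm_relators

/-- The pure singular braid group `SGP_n`. -/
abbrev SGP (n : ℕ) : Subgroup (SG n) := (toPerm n).ker

end SingularBraid

/-! With trivial coefficients, H₁ is the abelianization of SGP_n, and a basis of it is found by an
upper and a lower bound. Generation: killing every σ_i² and τ_1σ_1⁻¹ turns SG_n into a group with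
the Coxeter relations of the symmetric group, so SGP_n is the normal closure of these elements
(`SGP_eq_normalClosure`). As all σ_i are conjugate, the abelianization is spanned by the classes of
g a g⁻¹ with a = σ_1² or a = τ_1σ_1⁻¹. Multiplying g on the right by a pure element or by some σ_i
with i ≠ 2 does not change the class. Hence it depends only on the unordered pair g{1,2}
(`conjClass_eq_of_map_basePair_eq`), which leaves two classes per pair. Independence: counting
regular and singular crossings for each pair of strands is a homomorphism to a semidirect product
with the symmetric group (`crossings`). On the two classes of a pair the counts are (2,0) and (-1,1)
there and zero elsewhere. -/

namespace SingularBraid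

/-! ### Coxeter relations of the symmetric group -/

section Coxeter

variable {Q : Type*} [Group Q]

/-- The product `s (j + d - 1) * ⋯ * s (j + 1) * s j` of `d` consecutive letters. -/
def descProd (s : ℕ → Q) (j : ℕ) : ℕ → Q
  | 0 => 1
  | d + 1 => s (j + d) * descProd s j d

theorem descProd_succ' (s : ℕ → Q) (j d : ℕ) :
    descProd s j (d + 1) = descProd s (j + 1) d * s j := by
  induction d with
  | zero => simp [descProd]
  | succ d ih =>
    rw [descProd, ih, descProd, ← mul_assoc, show j + (d + 1) = j + 1 + d by omega]

theorem descProd_mul_of_lt {s : ℕ → Q} {n : ℕ}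
    (far : ∀ i j, i + 1 < j → j + 1 < n → s i * s j = s j * s i)
    {i j d : ℕ} (hij : i + 1 < j) (hd : j + d < n) :
    descProd s j d * s i = s i * descProd s j d := by
  induction d with
  | zero => simp [descProd]
  | succ d ih =>
    rw [descProd, mul_assoc, ih (by omega), ← mul_assoc, ← far i (j + d) (by omega) (by omega),
      mul_assoc]

/-- The letter commutes past the factors of much smaller index, meets its neighbour in a braid
relation that lowers its index by one, and commutes past the rest. -/
theorem descProd_mul_of_gt {s : ℕ → Q} {n : ℕ}
    (braid : ∀ i, i + 2 < n → s i * s (i + 1) * s i = s (i + 1) * s i * s (i + 1))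
    (far : ∀ i j, i + 1 < j → j + 1 < n → s i * s j = s j * s i)
    {i j d : ℕ} (hji : j ≤ i) (hid : i + 1 < j + d) (hd : j + d < n) :
    descProd s j d * s (i + 1) = s i * descProd s j d := by
  induction d with
  | zero => omega
  | succ d ih =>
    rcases Nat.lt_or_ge (i + 1) (j + d) with h | h
    · rw [descProd, mul_assoc, ih h (by omega), ← mul_assoc,
        ← far i (j + d) (by omega) (by omega), mul_assoc]
    · obtain ⟨d, rfl⟩ : ∃ d', d = d' + 1 := ⟨d - 1, by omega⟩
      obtain rfl : i = j + d := by omega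
      have h1 : descProd s j d * s (j + d + 1) = s (j + d + 1) * descProd s j d := by
        clear ih h hid
        have key : ∀ c, c ≤ d → descProd s j c * s (j + d + 1) = s (j + d + 1) * descProd s j c := by
          intro c hc
          induction c with
          | zero => simp [descProd]
          | succ c ih =>
            rw [descProd, mul_assoc, ih (by omega), ← mul_assoc,
              far (j + c) (j + d + 1) (by omega) (by omega), mul_assoc]
        exact key d le_rfl
      calc descProd s j (d + 1 + 1) * s (j + d + 1)
          = s (j + d + 1) * s (j + d) * (descProd s j d * s (j + d + 1)) := by
            simp only [descProd, ← add_assoc, mul_assoc]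
        _ = s (j + d) * s (j + d + 1) * s (j + d) * descProd s j d := by
            rw [h1, ← mul_assoc, braid (j + d) (by omega)]
        _ = s (j + d) * descProd s j (d + 1 + 1) := by
            simp only [descProd, ← add_assoc, mul_assoc]

/-- The subgroup generated by the first `k` letters. -/
def initialSubgroup (s : ℕ → Q) (k : ℕ) : Subgroup Q := Subgroup.closure (s '' Set.Iio k)

theorem mem_initialSubgroup (s : ℕ → Q) {i k : ℕ} (h : i < k) : s i ∈ initialSubgroup s k :=
  Subgroup.subset_closure ⟨i, h, rfl⟩

/-- The descending products ending at position k represent the cosets of the subgroup on one letter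
fewer. Right multiplication by a letter permutes these cosets: it lengthens or shortens the product
at its lower end, or passes through it into the subgroup. -/
theorem exists_normalForm {s : ℕ → Q} {n : ℕ}
    (sq : ∀ i, i + 1 < n → s i * s i = 1)
    (braid : ∀ i, i + 2 < n → s i * s (i + 1) * s i = s (i + 1) * s i * s (i + 1))
    (far : ∀ i j, i + 1 < j → j + 1 < n → s i * s j = s j * s i)
    {k : ℕ} (hk : k + 1 < n) {q : Q} (hq : q ∈ initialSubgroup s (k + 1)) :
    ∃ h ∈ initialSubgroup s k, ∃ j d, j + d = k + 1 ∧ q = h * descProd s j d := by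
  have step : ∀ q : Q, (∃ h ∈ initialSubgroup s k, ∃ j d, j + d = k + 1 ∧ q = h * descProd s j d) →
      ∀ i < k + 1, ∃ h ∈ initialSubgroup s k, ∃ j d, j + d = k + 1 ∧
        q * s i = h * descProd s j d := by
    rintro q ⟨h, hh, j, d, hjd, rfl⟩ i hi
    rcases Nat.lt_trichotomy (i + 1) j with hij | hij | hij
    · refine ⟨h * s i, mul_mem hh (mem_initialSubgroup s (by omega)), j, d, hjd, ?_⟩
      rw [mul_assoc, descProd_mul_of_lt far hij (by omega), mul_assoc]
    · subst hij
      exact ⟨h, hh, i, d + 1, by omega, by rw [descProd_succ', mul_assoc]⟩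
    · rcases Nat.lt_or_ge j i with hji | hji
      · obtain ⟨i, rfl⟩ : ∃ i', i = i' + 1 := ⟨i - 1, by omega⟩
        refine ⟨h * s i, mul_mem hh (mem_initialSubgroup s (by omega)), j, d, hjd, ?_⟩
        rw [mul_assoc, descProd_mul_of_gt braid far (by omega) (by omega) (by omega), mul_assoc]
      · obtain rfl : i = j := by omega
        obtain ⟨d, rfl⟩ : ∃ d', d = d' + 1 := ⟨d - 1, by omega⟩
        refine ⟨h, hh, i + 1, d, by omega, ?_⟩
        rw [descProd_succ', mul_assoc, mul_assoc, sq i (by omega), mul_one]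
  induction hq using Subgroup.closure_induction_right with
  | one => exact ⟨1, one_mem _, k + 1, 0, rfl, by simp [descProd]⟩
  | mul_right x hx y hy ih =>
    obtain ⟨i, hi, rfl⟩ := hy
    exact step x ih i hi
  | mul_inv_cancel x hx y hy ih =>
    obtain ⟨i, hi, rfl⟩ := hy
    rw [inv_eq_of_mul_eq_one_left (sq i (by simp at hi; omega))]
    exact step x ih i hi

/-- A group generated by elements that satisfy the Coxeter relations of the symmetric group and
that maps to the symmetric group accordingly does so injectively. -/
theorem injective_of_coxeter_relations {s : ℕ → Q} {n : ℕ}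
    (sq : ∀ i, i + 1 < n → s i * s i = 1)
    (braid : ∀ i, i + 2 < n → s i * s (i + 1) * s i = s (i + 1) * s i * s (i + 1))
    (far : ∀ i j, i + 1 < j → j + 1 < n → s i * s j = s j * s i)
    (gen : initialSubgroup s (n - 1) = ⊤) (f : Q →* Equiv.Perm (Fin n))
    (hf : ∀ i (h : i + 1 < n), f (s i) = Equiv.swap ⟨i, by omega⟩ ⟨i + 1, h⟩) :
    Function.Injective f := by
  have fix : ∀ k, k < n → ∀ h ∈ initialSubgroup s k, ∀ x : Fin n, k < x → f h x = x := by
    intro k hk h hh x hx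
    have : initialSubgroup s k ≤ (MulAction.stabilizer (Equiv.Perm (Fin n)) x).comap f := by
      refine (Subgroup.closure_le _).2 ?_
      rintro _ ⟨i, hi, rfl⟩
      simp only [Set.mem_Iio] at hi
      simp only [SetLike.mem_coe, Subgroup.mem_comap, MulAction.mem_stabilizer_iff]
      rw [hf i (by omega)]
      exact Equiv.swap_apply_of_ne_of_ne (by simp [Fin.ext_iff]; omega)
        (by simp [Fin.ext_iff]; omega)
    exact this hh
  have move : ∀ j d (h : j + d < n), f (descProd s j d) ⟨j, by omega⟩ = ⟨j + d, h⟩ := by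
    intro j d
    induction d with
    | zero => intro h; simp [descProd]
    | succ d ih =>
      intro h
      rw [descProd, map_mul, Equiv.Perm.mul_apply, ih (by omega), hf _ (by omega),
        Equiv.swap_apply_left]
      rfl
  have main : ∀ k, k < n → ∀ q ∈ initialSubgroup s k, f q = 1 → q = 1 := by
    intro k
    induction k with
    | zero =>
      intro _ q hq _
      simpa [initialSubgroup] using hq
    | succ k ih =>
      intro hk q hq hfq
      obtain ⟨h, hh, j, d, hjd, rfl⟩ := exists_normalForm sq braid far hk hq
      -- The descending product sends j to k + 1, which h fixes. Since q acts trivially, j = k + 1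
      -- and the product is empty.
      have h1 := Equiv.congr_fun hfq ⟨j, by omega⟩
      rw [map_mul, Equiv.Perm.mul_apply, move j d (by omega),
        fix k (by omega) h hh _ (by simp; omega)] at h1
      simp only [Equiv.Perm.one_apply, Fin.mk.injEq] at h1
      obtain rfl : d = 0 := by omega
      simp only [descProd, mul_one] at hfq ⊢
      exact ih (by omega) h hh hfq
  rw [injective_iff_map_eq_one]
  intro q hq
  rcases Nat.eq_zero_or_pos n with rfl | hn
  · have : q ∈ initialSubgroup s (0 - 1) := gen ▸ Subgroup.mem_top q
    simpa [initialSubgroup] using this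
  · exact main (n - 1) (by omega) q (gen ▸ Subgroup.mem_top q) hq

end Coxeter

/-! ### The pure group as a normal closure -/

/-- The element `σ_{i+1}` of `SG_n`, with junk value `1` when there is no such generator. -/
def sigma (n i : ℕ) : SG n := if h : i < n - 1 then PresentedGroup.of (Gen.σ ⟨i, h⟩) else 1

/-- The element `τ_1` of `SG_n`. -/
def tau {n : ℕ} (hn : 2 ≤ n) : SG n := PresentedGroup.of (Gen.τ₁ hn)

theorem mk_eq_mk {n : ℕ} {u v : FreeGroup (Gen n)} (h : Rel n u v) :
    PresentedGroup.mk (relators n) u = PresentedGroup.mk (relators n) v :=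
  PresentedGroup.mk_eq_mk_of_mul_inv_mem ⟨u, v, h, rfl⟩

theorem mk_s {n : ℕ} (i : Fin (n - 1)) : PresentedGroup.mk (relators n) (s i) = sigma n i := by
  rw [sigma, dif_pos i.2]; rfl

theorem mk_t {n : ℕ} (hn : 2 ≤ n) : PresentedGroup.mk (relators n) (t hn) = tau hn := rfl

theorem sigma_braid {n i : ℕ} (h : i + 2 < n) :
    sigma n i * sigma n (i + 1) * sigma n i = sigma n (i + 1) * sigma n i * sigma n (i + 1) := by
  simpa only [map_mul, mk_s] using
    mk_eq_mk (Rel.braid (n := n) ⟨i, by omega⟩ ⟨i + 1, by omega⟩ rfl)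

theorem sigma_far {n i j : ℕ} (hij : i + 1 < j) (h : j + 1 < n) :
    sigma n i * sigma n j = sigma n j * sigma n i := by
  simpa only [map_mul, mk_s] using
    mk_eq_mk (Rel.far (n := n) ⟨i, by omega⟩ ⟨j, by omega⟩ hij)

theorem sigma_tau {n i : ℕ} (hn : 2 ≤ n) (hi : i ≠ 1) (h : i + 1 < n) :
    sigma n i * tau hn = tau hn * sigma n i := by
  simpa only [map_mul, mk_s, mk_t] using mk_eq_mk (Rel.tau_sigma hn ⟨i, by omega⟩ hi)

theorem toPerm_sigma {n i : ℕ} (h : i + 1 < n) :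
    toPerm n (sigma n i) = Equiv.swap ⟨i, by omega⟩ ⟨i + 1, h⟩ := by
  rw [sigma, dif_pos (by omega)]
  exact PresentedGroup.toGroup.of _

theorem toPerm_tau {n : ℕ} (hn : 2 ≤ n) :
    toPerm n (tau hn) = Equiv.swap ⟨0, by omega⟩ ⟨1, by omega⟩ :=
  PresentedGroup.toGroup.of _

/-- The squares `σ_i²` and the element `τ_1 σ_1⁻¹`. -/
def kernelGens (n : ℕ) : Set (SG n) :=
  {w | (∃ i, i + 1 < n ∧ w = sigma n i * sigma n i) ∨ ∃ hn : 2 ≤ n, w = tau hn * (sigma n 0)⁻¹}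

theorem kernelGens_subset (n : ℕ) : kernelGens n ⊆ SGP n := by
  rintro w (⟨i, h, rfl⟩ | ⟨hn, rfl⟩)
  · simp [MonoidHom.mem_ker, toPerm_sigma h]
  · simp [MonoidHom.mem_ker, toPerm_sigma (i := 0) (show 0 + 1 < n by omega), toPerm_tau]

theorem SGP_eq_normalClosure (n : ℕ) : SGP n = Subgroup.normalClosure (kernelGens n) := by
  refine le_antisymm ?_ (Subgroup.normalClosure_le_normal (kernelGens_subset n))
  set N := Subgroup.normalClosure (kernelGens n) with hN
  have hle : N ≤ SGP n := Subgroup.normalClosure_le_normal (kernelGens_subset n)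
  let π : SG n →* SG n ⧸ N := QuotientGroup.mk' N
  have hπ : ∀ w ∈ kernelGens n, π w = 1 := fun w hw =>
    (QuotientGroup.eq_one_iff w).2 (Subgroup.subset_normalClosure hw)
  have gen : initialSubgroup (fun i => π (sigma n i)) (n - 1) = ⊤ := by
    rw [eq_top_iff, ← Subgroup.map_top_of_surjective π (QuotientGroup.mk'_surjective N),
      ← PresentedGroup.closure_range_of, MonoidHom.map_closure, Subgroup.closure_le]
    have key : ∀ i, i + 1 < n → π (sigma n i) ∈ initialSubgroup (fun i => π (sigma n i)) (n - 1) :=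
      fun i hi => mem_initialSubgroup (fun i => π (sigma n i)) (by omega)
    rintro _ ⟨_, ⟨x, rfl⟩, rfl⟩
    cases x with
    | σ i =>
      have := key i (by omega)
      rwa [sigma, dif_pos i.2] at this
    | τ₁ hn =>
      have h1 := hπ (tau hn * (sigma n 0)⁻¹) (Or.inr ⟨hn, rfl⟩)
      rw [map_mul, map_inv, mul_inv_eq_one] at h1
      have := key 0 (by omega)
      rwa [← h1] at this
  have inj := injective_of_coxeter_relations (s := fun i => π (sigma n i)) (n := n)
    (fun i hi => by rw [← map_mul]; exact hπ _ (Or.inl ⟨i, hi, rfl⟩))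
    (fun i hi => by simp only [← map_mul]; rw [sigma_braid hi])
    (fun i j hij hj => by simp only [← map_mul]; rw [sigma_far hij hj]) gen
    (QuotientGroup.lift N (toPerm n) fun g hg => hle hg)
    (fun i hi => toPerm_sigma hi)
  intro g hg
  refine (QuotientGroup.eq_one_iff g).1 (inj ?_)
  rw [map_one]
  exact hg

/-! ### Stabilizers in the symmetric group -/

theorem swap_mem_of_adjacent {n l : ℕ} {H : Subgroup (Equiv.Perm (Fin n))}
    (h : ∀ i, l ≤ i → ∀ hi : i + 1 < n, Equiv.swap ⟨i, by omega⟩ ⟨i + 1, hi⟩ ∈ H)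
    {a b : ℕ} (hla : l ≤ a) (hab : a < b) (hb : b < n) :
    Equiv.swap (⟨a, by omega⟩ : Fin n) ⟨b, hb⟩ ∈ H := by
  induction b, hab using Nat.le_induction with
  | base => exact h a hla hb
  | succ b hab ih =>
    have h1 := ih (by omega)
    have h2 := h b (by omega) hb
    rw [Equiv.swap_comm, ← Equiv.swap_mul_swap_mul_swap (x := ⟨a, by omega⟩)
      (y := (⟨b, by omega⟩ : Fin n)) (by simp [Fin.ext_iff]; omega) (by simp [Fin.ext_iff]; omega)]
    exact mul_mem (mul_mem h2 h1) h2

/-- A permutation that fixes the first `l` points lies in any subgroup that contains the remaining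
adjacent transpositions. -/
theorem mem_of_fixes_initial {n l : ℕ} {H : Subgroup (Equiv.Perm (Fin n))}
    (h : ∀ i, l ≤ i → ∀ hi : i + 1 < n, Equiv.swap ⟨i, by omega⟩ ⟨i + 1, hi⟩ ∈ H)
    {p : Equiv.Perm (Fin n)} (hp : ∀ x : Fin n, (x : ℕ) < l → p x = x) : p ∈ H := by
  have hp' : ∀ x : Fin n, l ≤ (p x : ℕ) ↔ l ≤ (x : ℕ) := by
    intro x
    rw [← not_iff_not, not_le, not_le]
    refine ⟨fun hx => ?_, fun hx => by rwa [hp x hx]⟩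
    rwa [p.injective (hp _ hx)] at hx
  rw [← Equiv.Perm.ofSubtype_subtypePerm (p := fun x : Fin n => l ≤ (x : ℕ)) hp'
    (fun x hx => by by_contra hlt; exact hx (hp x (by omega)))]
  generalize Equiv.Perm.subtypePerm (p := fun x : Fin n => l ≤ (x : ℕ)) p hp' = q
  induction q using Equiv.Perm.swap_induction_on with
  | one => simp
  | swap_mul f x y hxy ih =>
    rw [map_mul, Equiv.Perm.ofSubtype_swap_eq]
    refine mul_mem ?_ ih
    rcases lt_or_gt_of_ne (fun he => hxy (Subtype.ext (Fin.ext he)) : (x.1 : ℕ) ≠ y.1) with hlt | hlt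
    · exact swap_mem_of_adjacent h x.2 hlt y.1.2
    · rw [Equiv.swap_comm]
      exact swap_mem_of_adjacent h y.2 hlt x.1.2

theorem toPerm_surjective (n : ℕ) : Function.Surjective (toPerm n) := fun p =>
  mem_of_fixes_initial (l := 0) (H := (toPerm n).range)
    (fun i _ hi => ⟨sigma n i, toPerm_sigma hi⟩) (fun _ h => absurd h (by omega))

/-- The first two points. -/
def basePair {n : ℕ} (hn : 2 ≤ n) : Sym2 (Fin n) := s(⟨0, by omega⟩, ⟨1, by omega⟩)

/-- Up to the swap of the first two points, p fixes both of them, so the transpositions further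
right suffice. -/
theorem mem_of_map_basePair {n : ℕ} (hn : 2 ≤ n) {H : Subgroup (Equiv.Perm (Fin n))}
    (h : ∀ i, i ≠ 1 → ∀ hi : i + 1 < n, Equiv.swap ⟨i, by omega⟩ ⟨i + 1, hi⟩ ∈ H)
    {p : Equiv.Perm (Fin n)} (hp : (basePair hn).map p = basePair hn) : p ∈ H := by
  have key : ∀ q : Equiv.Perm (Fin n), q ⟨0, by omega⟩ = ⟨0, by omega⟩ →
      q ⟨1, by omega⟩ = ⟨1, by omega⟩ → q ∈ H := by
    intro q h0 h1
    refine mem_of_fixes_initial (l := 2) (fun i hi => h i (by omega)) fun x hx => ?_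
    rcases (by omega : (x : ℕ) = 0 ∨ (x : ℕ) = 1) with hx | hx
    · rwa [show x = ⟨0, by omega⟩ from Fin.ext hx]
    · rwa [show x = ⟨1, by omega⟩ from Fin.ext hx]
  simp only [basePair, Sym2.map_mk, Sym2.eq_iff] at hp
  rcases hp with ⟨h0, h1⟩ | ⟨h0, h1⟩
  · exact key p h0 h1
  · have h2 := h 0 (by omega) (by omega)
    rw [← mul_mem_cancel_left h2]
    refine key _ ?_ ?_
    · rw [Equiv.Perm.mul_apply, h0]
      exact Equiv.swap_apply_right _ _
    · rw [Equiv.Perm.mul_apply, h1]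
      exact Equiv.swap_apply_left _ _

/-! ### Crossing numbers with values in a semidirect product -/

/-- The permutation of unordered pairs induced by a permutation of points. -/
def sym2Perm {α : Type*} (p : Equiv.Perm α) : Equiv.Perm (Sym2 α) where
  toFun := Sym2.map p
  invFun := Sym2.map p.symm
  left_inv e := by simp [Sym2.map_map]
  right_inv e := by simp [Sym2.map_map]

/-- The action of the symmetric group on weights of unordered pairs. -/
noncomputable def weightAction (n : ℕ) :
    Equiv.Perm (Fin n) →* MulAut (Multiplicative (Sym2 (Fin n) →₀ ℤ × ℤ)) where
  toFun p := (Finsupp.domCongr (sym2Perm p)).toMultiplicative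
  map_one' := by
    refine MulEquiv.ext fun f => Multiplicative.toAdd.injective (Finsupp.ext fun e => ?_)
    change f.toAdd (e.map _) = f.toAdd e
    exact congrArg _ (Sym2.map_id' ▸ rfl)
  map_mul' p q := by
    refine MulEquiv.ext fun f => Multiplicative.toAdd.injective (Finsupp.ext fun e => ?_)
    change f.toAdd (e.map _) = f.toAdd ((e.map _).map _)
    rw [Sym2.map_map]
    rfl

theorem weightAction_single {n : ℕ} (p : Equiv.Perm (Fin n)) (e : Sym2 (Fin n)) (c : ℤ × ℤ) :
    weightAction n p (Multiplicative.ofAdd (Finsupp.single e c)) =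
      Multiplicative.ofAdd (Finsupp.single (e.map p) c) :=
  congrArg Multiplicative.ofAdd (Finsupp.equivMapDomain_single _ _ _)

/-- The semidirect product of the weights of unordered pairs with the symmetric group. -/
abbrev WeightGroup (n : ℕ) : Type :=
  Multiplicative (Sym2 (Fin n) →₀ ℤ × ℤ) ⋊[weightAction n] Equiv.Perm (Fin n)

/-- The transposition of `x` and `y`, with weight `c` on the pair that it interchanges. -/
noncomputable def weightedSwap {n : ℕ} (x y : Fin n) (c : ℤ × ℤ) : WeightGroup n :=
  ⟨Multiplicative.ofAdd (Finsupp.single s(x, y) c), Equiv.swap x y⟩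

/-- Regular crossings count in the first component, the singular ones in the second. -/
noncomputable def genWeight {n : ℕ} : Gen n → WeightGroup n
  | Gen.σ i => weightedSwap ⟨i, by omega⟩ ⟨(i : ℕ) + 1, by omega⟩ (1, 0)
  | Gen.τ₁ hn => weightedSwap ⟨0, by omega⟩ ⟨1, by omega⟩ (0, 1)

theorem weightedSwap_comm {n : ℕ} (x y : Fin n) (c : ℤ × ℤ) :
    weightedSwap x y c = weightedSwap y x c := by
  rw [weightedSwap, weightedSwap, Sym2.eq_swap, Equiv.swap_comm]

theorem weightedSwap_mul_self {n : ℕ} (x y : Fin n) (c d : ℤ × ℤ) :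
    weightedSwap x y c * weightedSwap x y d =
      ⟨Multiplicative.ofAdd (Finsupp.single s(x, y) (c + d)), 1⟩ := by
  refine SemidirectProduct.ext ?_ (Equiv.swap_mul_self x y)
  simp only [weightedSwap, SemidirectProduct.mul_left, weightAction_single, Sym2.map_mk,
    Equiv.swap_apply_left, Equiv.swap_apply_right, Sym2.eq_swap (a := y) (b := x),
    ← ofAdd_add, ← Finsupp.single_add]

theorem weightedSwap_mul_of_disjoint {n : ℕ} {x y z w : Fin n} (hxz : x ≠ z) (hxw : x ≠ w)
    (hyz : y ≠ z) (hyw : y ≠ w) (c d : ℤ × ℤ) :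
    weightedSwap x y c * weightedSwap z w d = weightedSwap z w d * weightedSwap x y c := by
  refine SemidirectProduct.ext ?_ ?_
  · simp only [weightedSwap, SemidirectProduct.mul_left, weightAction_single, Sym2.map_mk]
    rw [Equiv.swap_apply_of_ne_of_ne hxz.symm hyz.symm,
      Equiv.swap_apply_of_ne_of_ne hxw.symm hyw.symm, Equiv.swap_apply_of_ne_of_ne hxz hxw,
      Equiv.swap_apply_of_ne_of_ne hyz hyw, mul_comm]
  · exact (Equiv.Perm.disjoint_iff_eq_or_eq.2 fun a => by
      simp only [weightedSwap, Equiv.swap_apply_def]; grind).commute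

/-- Both sides put c on {x,y} and {x,z} and d on {y,z}. The case d = c is the braid relation; a
general d lets a singular crossing slide to the neighbouring position, where SG_n has no generator
τ. -/
theorem weightedSwap_braid {n : ℕ} {x y z : Fin n} (hxy : x ≠ y) (hxz : x ≠ z) (hyz : y ≠ z)
    (c d : ℤ × ℤ) :
    weightedSwap x y c * weightedSwap y z c * weightedSwap x y d =
      weightedSwap y z d * weightedSwap x y c * weightedSwap y z c := by
  refine SemidirectProduct.ext ?_ ?_
  · apply Multiplicative.toAdd.injective
    simp [weightedSwap, weightAction_single, Equiv.swap_apply_of_ne_of_ne, hxy, hxz, hxz.symm,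
      hyz.symm]
    abel
  · simp only [weightedSwap, SemidirectProduct.mul_right]
    ext a
    simp only [Equiv.Perm.mul_apply, Equiv.swap_apply_def]
    grind

/-- The singular crossing slides from {x,y} to {y,z} through half of the loop and back through the
other half. -/
theorem weightedSwap_loop {n : ℕ} {x y z : Fin n} (hxy : x ≠ y) (hxz : x ≠ z) (hyz : y ≠ z)
    (c d : ℤ × ℤ) :
    weightedSwap y z c * weightedSwap x y c ^ 2 * weightedSwap y z c * weightedSwap x y d =
      weightedSwap x y d * weightedSwap y z c * weightedSwap x y c ^ 2 * weightedSwap y z c := by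
  have h1 := weightedSwap_braid hxy hxz hyz c d
  have h2 := weightedSwap_braid hyz.symm hxz.symm hxy.symm c d
  rw [weightedSwap_comm z y, weightedSwap_comm z y, weightedSwap_comm y x,
    weightedSwap_comm y x] at h2
  generalize weightedSwap x y c = s₁ at *
  generalize weightedSwap y z c = s₂ at *
  generalize weightedSwap x y d = t₁ at *
  generalize weightedSwap y z d = t₂ at *
  calc s₂ * s₁ ^ 2 * s₂ * t₁ = s₂ * s₁ * (s₁ * s₂ * t₁) := by simp only [pow_two, mul_assoc]
    _ = s₂ * s₁ * t₂ * (s₁ * s₂) := by rw [h1]; group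
    _ = t₁ * s₂ * s₁ ^ 2 * s₂ := by rw [h2]; simp only [pow_two, mul_assoc]

/-- The word W = s₂s₃s₁s₂ exchanges t₁ and t₃ when they move across it, and t₁ and t₃ commute
because their supports are disjoint. -/
theorem weightedSwap_double {n : ℕ} {x y z w : Fin n} (hxy : x ≠ y) (hxz : x ≠ z) (hxw : x ≠ w)
    (hyz : y ≠ z) (hyw : y ≠ w) (hzw : z ≠ w) (c d : ℤ × ℤ) :
    weightedSwap y z c * weightedSwap z w c * weightedSwap x y c * weightedSwap y z c *
        weightedSwap x y d * weightedSwap y z c * weightedSwap z w c * weightedSwap x y c *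
        weightedSwap y z c * weightedSwap x y d =
      weightedSwap x y d * weightedSwap y z c * weightedSwap z w c * weightedSwap x y c *
        weightedSwap y z c * weightedSwap x y d * weightedSwap y z c * weightedSwap z w c *
        weightedSwap x y c * weightedSwap y z c := by
  have h1 := weightedSwap_braid hxy hxz hyz c d
  have h2 := weightedSwap_braid hyz hyw hzw c d
  have h3 := weightedSwap_braid hyz.symm hxz.symm hxy.symm c d
  have h4 := weightedSwap_braid hzw.symm hyw.symm hyz.symm c d
  have h5 := weightedSwap_mul_of_disjoint hxz hxw hyz hyw c c
  have h6 := weightedSwap_mul_of_disjoint hxz hxw hyz hyw d d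
  rw [weightedSwap_comm z y, weightedSwap_comm z y, weightedSwap_comm y x,
    weightedSwap_comm y x] at h3
  rw [weightedSwap_comm w z, weightedSwap_comm w z, weightedSwap_comm z y,
    weightedSwap_comm z y] at h4
  generalize weightedSwap x y c = s₁ at *
  generalize weightedSwap y z c = s₂ at *
  generalize weightedSwap z w c = s₃ at *
  generalize weightedSwap x y d = t₁ at *
  generalize weightedSwap y z d = t₂ at *
  generalize weightedSwap z w d = t₃ at *
  have h13 : s₂ * s₃ * s₁ * s₂ * t₁ = t₃ * (s₂ * s₃ * s₁ * s₂) := by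
    calc s₂ * s₃ * s₁ * s₂ * t₁ = s₂ * s₃ * (s₁ * s₂ * t₁) := by group
      _ = s₂ * s₃ * t₂ * (s₁ * s₂) := by rw [h1]; group
      _ = t₃ * (s₂ * s₃ * s₁ * s₂) := by rw [h2]; group
  have h31 : s₂ * s₃ * s₁ * s₂ * t₃ = t₁ * (s₂ * s₃ * s₁ * s₂) := by
    calc s₂ * s₃ * s₁ * s₂ * t₃ = s₂ * (s₁ * s₃) * s₂ * t₃ := by rw [h5]; group
      _ = s₂ * s₁ * (s₃ * s₂ * t₃) := by group
      _ = s₂ * s₁ * t₂ * (s₃ * s₂) := by rw [h4]; group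
      _ = t₁ * s₂ * (s₁ * s₃) * s₂ := by rw [h3]; group
      _ = t₁ * (s₂ * s₃ * s₁ * s₂) := by rw [h5]; group
  have key : ∀ W : WeightGroup n, W * t₁ = t₃ * W → W * t₃ = t₁ * W →
      W * t₁ * W * t₁ = t₁ * W * t₁ * W := by
    intro W h h'
    calc W * t₁ * W * t₁ = W * t₁ * (W * t₁) := by group
      _ = W * t₁ * (t₃ * W) := congrArg _ h
      _ = W * (t₁ * t₃) * W := by group
      _ = W * t₃ * t₁ * W := by rw [h6]; group
      _ = t₁ * W * t₁ * W := by rw [h']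
  simpa only [mul_assoc] using key _ h13 h31

theorem genWeight_rel {n : ℕ} {u v : FreeGroup (Gen n)} (h : Rel n u v) :
    FreeGroup.lift genWeight u = FreeGroup.lift genWeight v := by
  cases h with
  | braid i j hij =>
    have hj : (⟨j, by omega⟩ : Fin n) = ⟨i + 1, by omega⟩ := Fin.ext hij.symm
    simp only [s, genWeight, map_mul, FreeGroup.lift_apply_of, hj]
    apply weightedSwap_braid <;> simp [Fin.ext_iff] <;> omega
  | far i j hij =>
    simp only [s, genWeight, map_mul, FreeGroup.lift_apply_of]
    apply weightedSwap_mul_of_disjoint <;> simp [Fin.ext_iff] <;> omega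
  | tau_loop hn i j hi hj =>
    simp only [s, t, genWeight, map_mul, map_pow, FreeGroup.lift_apply_of, hi, hj]
    apply weightedSwap_loop <;> simp [Fin.ext_iff]
  | tau_sigma hn i hi =>
    simp only [s, t, genWeight, map_mul, FreeGroup.lift_apply_of]
    rcases Nat.eq_zero_or_pos (i : ℕ) with h0 | h1
    · simp only [h0, zero_add, weightedSwap_mul_self, add_comm]
    · apply weightedSwap_mul_of_disjoint <;> simp [Fin.ext_iff] <;> omega
  | tau_tau hn i j k hi hj hk =>
    simp only [s, t, genWeight, map_mul, FreeGroup.lift_apply_of, hi, hj, hk]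
    apply weightedSwap_double <;> simp [Fin.ext_iff]

theorem genWeight_relators {n : ℕ} :
    ∀ r ∈ relators n, FreeGroup.lift (genWeight (n := n)) r = 1 := by
  rintro r ⟨u, v, huv, rfl⟩
  rw [map_mul, map_inv, genWeight_rel huv, mul_inv_cancel]

/-- The homomorphism that counts crossings between any two strands. -/
noncomputable def crossings (n : ℕ) : SG n →* WeightGroup n :=
  PresentedGroup.toGroup genWeight_relators

theorem crossings_right {n : ℕ} (g : SG n) : (crossings n g).right = toPerm n g := by
  have : SemidirectProduct.rightHom.comp (crossings n) = toPerm n := by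
    refine PresentedGroup.ext fun x => ?_
    simp only [MonoidHom.comp_apply, crossings, toPerm, PresentedGroup.toGroup.of]
    cases x <;> rfl
  exact DFunLike.congr_fun this g

theorem crossings_sigma {n i : ℕ} (h : i + 1 < n) :
    crossings n (sigma n i) = weightedSwap ⟨i, by omega⟩ ⟨i + 1, h⟩ (1, 0) := by
  rw [sigma, dif_pos (by omega)]
  exact PresentedGroup.toGroup.of _

theorem crossings_tau {n : ℕ} (hn : 2 ≤ n) :
    crossings n (tau hn) = weightedSwap ⟨0, by omega⟩ ⟨1, by omega⟩ (0, 1) :=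
  PresentedGroup.toGroup.of _

/-! ### Classes of conjugates in the abelianization -/

theorem commute_sigma {n i : ℕ} (hi : i ≠ 1) (h : i + 1 < n) :
    Commute (sigma n i) (sigma n 0) := by
  rcases Nat.eq_zero_or_pos i with rfl | hi0
  · exact Commute.refl _
  · exact (sigma_far (by omega) h).symm

/-- The class in the abelianization of `SGP_n` of a conjugate of an element of `SGP_n`. -/
def conjClass {n : ℕ} (a : SGP n) (g : SG n) : Abelianization (SGP n) :=
  Abelianization.of ⟨g * a * g⁻¹, (inferInstance : (SGP n).Normal).conj_mem a a.2 g⟩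

theorem of_eq_conjClass {n : ℕ} {a : SGP n} {g w : SG n} (hw : w ∈ SGP n) (h : w = g * a * g⁻¹) :
    Abelianization.of (⟨w, hw⟩ : SGP n) = conjClass a g := by
  subst h
  rfl

/-- The two representatives are conjugate by g k g⁻¹, which is pure by normality, so they agree in
the abelianization. -/
theorem conjClass_mul {n : ℕ} (a k : SGP n) (g : SG n) :
    conjClass a (g * k) = conjClass a g := by
  have hk : g * k * g⁻¹ ∈ SGP n := (inferInstance : (SGP n).Normal).conj_mem k k.2 g
  have hg : g * a * g⁻¹ ∈ SGP n := (inferInstance : (SGP n).Normal).conj_mem a a.2 g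
  have : conjClass a (g * k) =
      Abelianization.of (⟨_, hk⟩ * ⟨_, hg⟩ * (⟨_, hk⟩ : SGP n)⁻¹) := by
    refine congrArg Abelianization.of (Subtype.ext ?_)
    simp only [Subgroup.coe_mul, Subgroup.coe_inv]
    group
  rw [this, map_mul, map_mul, map_inv, mul_comm, inv_mul_cancel_left]
  rfl

theorem conjClass_mul_of_commute {n : ℕ} {a : SGP n} {c : SG n} (h : Commute c a) (g : SG n) :
    conjClass a (g * c) = conjClass a g := by
  refine congrArg Abelianization.of (Subtype.ext ?_)
  change g * c * a * (g * c)⁻¹ = g * a * g⁻¹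
  rw [mul_assoc g c, h.eq]
  group

/-- The class of a conjugate of an element supported on the first two strands depends only on the
positions of these strands after the conjugation. -/
theorem conjClass_eq_of_map_basePair_eq {n : ℕ} (hn : 2 ≤ n) {a : SGP n}
    (ha : ∀ i, i ≠ 1 → i + 1 < n → Commute (sigma n i) a) {g h : SG n}
    (hgh : (basePair hn).map (toPerm n g) = (basePair hn).map (toPerm n h)) :
    conjClass a g = conjClass a h := by
  -- The permutation of h⁻¹g stabilizes the base pair, and the centralizer of a already realizes
  -- this whole stabilizer. So h⁻¹g is a pure element times an element commuting with a.
  have hmem : toPerm n (h⁻¹ * g) ∈ (Subgroup.centralizer {(a : SG n)}).map (toPerm n) := by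
    refine mem_of_map_basePair hn
      (fun i hi hi' => Subgroup.mem_map.2 ⟨sigma n i, ?_, toPerm_sigma hi'⟩) ?_
    · exact Subgroup.mem_centralizer_singleton_iff.2 (ha i hi hi').eq
    · rw [map_mul, Equiv.Perm.coe_mul, ← Sym2.map_map, hgh, Sym2.map_map, map_inv]
      simp
  obtain ⟨c, hc, hcg⟩ := hmem
  have hk : h⁻¹ * g * c⁻¹ ∈ SGP n := by
    rw [MonoidHom.mem_ker, map_mul, map_inv, hcg, mul_inv_cancel]
  have hc' : Commute c a := Subgroup.mem_centralizer_singleton_iff.1 hc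
  have hg : g = h * (⟨_, hk⟩ : SGP n) * c := by simp only; group
  rw [hg, conjClass_mul_of_commute hc', conjClass_mul]

/-- The pure braid `σ_1²`. -/
def sigmaSq {n : ℕ} (hn : 2 ≤ n) : SGP n :=
  ⟨sigma n 0 * sigma n 0, kernelGens_subset n (Or.inl ⟨0, by omega, rfl⟩)⟩

/-- The pure singular braid `τ_1 σ_1⁻¹`. -/
def tauSigmaInv {n : ℕ} (hn : 2 ≤ n) : SGP n :=
  ⟨tau hn * (sigma n 0)⁻¹, kernelGens_subset n (Or.inr ⟨hn, rfl⟩)⟩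

/-- Unordered pairs of distinct strands. -/
abbrev StrandPair (n : ℕ) : Type := {e : Sym2 (Fin n) // ¬ e.IsDiag}

theorem exists_map_basePair {n : ℕ} (hn : 2 ≤ n) (e : StrandPair n) :
    ∃ g : SG n, (basePair hn).map (toPerm n g) = e := by
  obtain ⟨e, he⟩ := e
  induction e with | _ x y
  obtain ⟨p, hp⟩ : ∃ p : Equiv.Perm (Fin n), (basePair hn).map p = s(x, y) := by
    have hxy : x ≠ y := by simpa using he
    -- The right factor sends 0 to x; the left one then sends the image of 1 to y without moving x.
    refine ⟨Equiv.swap (Equiv.swap ⟨0, by omega⟩ x ⟨1, by omega⟩) y * Equiv.swap ⟨0, by omega⟩ x, ?_⟩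
    have h0 : Equiv.swap (⟨0, by omega⟩ : Fin n) x ⟨1, by omega⟩ ≠ x := by
      rw [Ne, Equiv.swap_apply_eq_iff, Equiv.swap_apply_right]
      simp
    simp [basePair, Equiv.swap_apply_of_ne_of_ne h0.symm hxy]
  obtain ⟨g, rfl⟩ := toPerm_surjective n p
  exact ⟨g, hp⟩

/-- A braid that moves the first two strands to the given positions. -/
noncomputable def mover {n : ℕ} (hn : 2 ≤ n) (e : StrandPair n) : SG n :=
  (exists_map_basePair hn e).choose

theorem mover_spec {n : ℕ} (hn : 2 ≤ n) (e : StrandPair n) :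
    (basePair hn).map (toPerm n (mover hn e)) = e :=
  (exists_map_basePair hn e).choose_spec

/-- For every pair of strands, the class of a full twist and of a singular crossing. -/
noncomputable def pureClass {n : ℕ} (hn : 2 ≤ n) :
    StrandPair n ⊕ StrandPair n → Additive (Abelianization (SGP n))
  | Sum.inl e => Additive.ofMul (conjClass (sigmaSq hn) (mover hn e))
  | Sum.inr e => Additive.ofMul (conjClass (tauSigmaInv hn) (mover hn e))

/-- By the braid relation, σ_iσ_{i+1} conjugates σ_i to σ_{i+1}. This reduces every σ_i² to a
conjugate of σ_1². -/
theorem exists_conj_sigma {n : ℕ} (i : ℕ) (hi : i + 1 < n) :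
    ∃ g : SG n, sigma n i = g * sigma n 0 * g⁻¹ := by
  induction i with
  | zero => exact ⟨1, by simp⟩
  | succ i ih =>
    obtain ⟨g, hg⟩ := ih (by omega)
    refine ⟨sigma n i * sigma n (i + 1) * g, ?_⟩
    have h := sigma_braid hi
    calc sigma n (i + 1)
        = sigma n (i + 1) * sigma n i * sigma n (i + 1) *
            (sigma n i * sigma n (i + 1))⁻¹ := by group
      _ = sigma n i * sigma n (i + 1) * sigma n i * (sigma n i * sigma n (i + 1))⁻¹ := by rw [h]
      _ = sigma n i * sigma n (i + 1) * (g * sigma n 0 * g⁻¹) *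
            (sigma n i * sigma n (i + 1))⁻¹ := by rw [← hg]
      _ = _ := by group

theorem exists_mover {n : ℕ} (hn : 2 ≤ n) {a : SGP n}
    (ha : ∀ i, i ≠ 1 → i + 1 < n → Commute (sigma n i) a) (g : SG n) :
    ∃ e : StrandPair n, conjClass a g = conjClass a (mover hn e) := by
  have h : ¬ ((basePair hn).map (toPerm n g)).IsDiag := by simp [basePair]
  exact ⟨⟨_, h⟩, conjClass_eq_of_map_basePair_eq hn ha (mover_spec hn ⟨_, h⟩).symm⟩

theorem commute_sigmaSq {n : ℕ} (hn : 2 ≤ n) (i : ℕ) (hi : i ≠ 1) (h : i + 1 < n) :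
    Commute (sigma n i) (sigmaSq hn) :=
  (commute_sigma hi h).mul_right (commute_sigma hi h)

theorem commute_tauSigmaInv {n : ℕ} (hn : 2 ≤ n) (i : ℕ) (hi : i ≠ 1) (h : i + 1 < n) :
    Commute (sigma n i) (tauSigmaInv hn) :=
  Commute.mul_right (sigma_tau hn hi h) (commute_sigma hi h).inv_right

theorem span_pureClass {n : ℕ} (hn : 2 ≤ n) :
    Submodule.span ℤ (Set.range (pureClass hn)) = ⊤ := by
  set S := Submodule.span ℤ (Set.range (pureClass hn)) with hS
  have hbase : ∀ w ∈ kernelGens n, ∀ g : SG n, ∀ h : g * w * g⁻¹ ∈ SGP n,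
      Additive.ofMul (Abelianization.of (⟨g * w * g⁻¹, h⟩ : SGP n)) ∈ S := by
    rintro w (⟨i, hi, rfl⟩ | ⟨hn', rfl⟩) g hw
    · obtain ⟨k, hk⟩ := exists_conj_sigma i hi
      obtain ⟨e, he⟩ := exists_mover hn (commute_sigmaSq hn) (g * k)
      rw [of_eq_conjClass (a := sigmaSq hn) (g := g * k) hw (by rw [hk, sigmaSq]; group), he]
      exact Submodule.subset_span ⟨Sum.inl e, rfl⟩
    · obtain ⟨e, he⟩ := exists_mover hn (commute_tauSigmaInv hn) g
      rw [of_eq_conjClass (a := tauSigmaInv hn) (g := g) hw rfl, he]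
      exact Submodule.subset_span ⟨Sum.inr e, rfl⟩
  have hmem : ∀ w (hw : w ∈ Subgroup.closure (Group.conjugatesOfSet (kernelGens n)))
      (hw' : w ∈ SGP n), Additive.ofMul (Abelianization.of (⟨w, hw'⟩ : SGP n)) ∈ S := by
    intro w hw
    induction hw using Subgroup.closure_induction with
    | mem w hw =>
      intro hw'
      obtain ⟨a, ha, hc⟩ := Group.mem_conjugatesOfSet_iff.1 hw
      obtain ⟨g, rfl⟩ := isConj_iff.1 hc
      exact hbase a ha g hw'
    | one => intro _; exact S.zero_mem
    | mul x y hx hy ihx ihy =>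
      intro _
      have hx' : x ∈ SGP n := by rw [SGP_eq_normalClosure]; exact hx
      have hy' : y ∈ SGP n := by rw [SGP_eq_normalClosure]; exact hy
      exact S.add_mem (ihx hx') (ihy hy')
    | inv x hx ih =>
      intro h
      exact S.neg_mem (ih (inv_mem_iff.1 h))
  rw [eq_top_iff]
  rintro x -
  obtain ⟨⟨w, hw⟩, rfl⟩ := QuotientGroup.mk_surjective x
  refine hmem w ?_ hw
  rw [SGP_eq_normalClosure] at hw
  exact hw

/-! ### Independence of the classes, and the rank -/

/-- The crossing numbers of pure singular braids. -/
noncomputable def pureCrossings (n : ℕ) :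
    SGP n →* Multiplicative (Sym2 (Fin n) →₀ ℤ × ℤ) where
  toFun g := (crossings n g).left
  map_one' := by simp
  -- The twist in the semidirect product is the permutation of g, trivial for pure g.
  map_mul' g h := by
    have hg : toPerm n g = 1 := g.2
    simp [crossings_right, hg]

/-- The crossing numbers, as a linear map on the abelianization. -/
noncomputable def abelianCrossings (n : ℕ) :
    Additive (Abelianization (SGP n)) →ₗ[ℤ] (Sym2 (Fin n) →₀ ℤ × ℤ) :=
  (MonoidHom.toAdditiveLeft (Abelianization.lift (pureCrossings n))).toIntLinearMap

theorem abelianCrossings_conjClass {n : ℕ} {a : SGP n} {e : Sym2 (Fin n)} {c : ℤ × ℤ}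
    (ha : crossings n a = ⟨Multiplicative.ofAdd (Finsupp.single e c), 1⟩) (g : SG n) :
    abelianCrossings n (Additive.ofMul (conjClass a g)) =
      Finsupp.single (e.map (toPerm n g)) c := by
  change Multiplicative.toAdd (crossings n (g * a * g⁻¹)).left = _
  rw [map_mul, map_mul, ha, map_inv]
  simp [crossings_right, weightAction_single]

theorem abelianCrossings_pureClass_inl {n : ℕ} (hn : 2 ≤ n) (e : StrandPair n) :
    abelianCrossings n (pureClass hn (Sum.inl e)) = Finsupp.single (e : Sym2 (Fin n)) (2, 0) := by
  rw [pureClass, abelianCrossings_conjClass (e := basePair hn) (c := (2, 0)), mover_spec]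
  rw [sigmaSq, map_mul, crossings_sigma (by omega), weightedSwap_mul_self]
  rfl

theorem abelianCrossings_pureClass_inr {n : ℕ} (hn : 2 ≤ n) (e : StrandPair n) :
    abelianCrossings n (pureClass hn (Sum.inr e)) = Finsupp.single (e : Sym2 (Fin n)) (-1, 1) := by
  rw [pureClass, abelianCrossings_conjClass (e := basePair hn) (c := (-1, 1)), mover_spec]
  rw [tauSigmaInv, map_mul, map_inv, mul_inv_eq_iff_eq_mul, crossings_sigma (by omega),
    crossings_tau]
  refine SemidirectProduct.ext ?_ ?_
  · simp [weightedSwap, basePair, ← ofAdd_add, ← Finsupp.single_add]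
  · simp [weightedSwap]

/-- The vectors (2,0) and (-1,1) span only a sublattice of index 2 in ℤ², but independence is
enough, as the classes are already known to span. -/
theorem linearIndependent_pureClass {n : ℕ} (hn : 2 ≤ n) :
    LinearIndependent ℤ (pureClass hn) := by
  rw [Fintype.linearIndependent_iff]
  intro c hc
  have h1 := congrArg (abelianCrossings n) hc
  simp only [Fintype.sum_sum_type, map_add, map_sum, map_smul, abelianCrossings_pureClass_inl,
    abelianCrossings_pureClass_inr, map_zero, Finsupp.smul_single] at h1
  have h2 : ∀ e : StrandPair n,
      c (Sum.inl e) • ((2, 0) : ℤ × ℤ) + c (Sum.inr e) • ((-1, 1) : ℤ × ℤ) = 0 := by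
    intro e
    have h3 := DFunLike.congr_fun h1 (e : Sym2 (Fin n))
    simpa [Finsupp.finsetSum_apply, Finsupp.single_apply, Subtype.val_inj] using h3
  have h4 : ∀ e, c (Sum.inl e) = 0 ∧ c (Sum.inr e) = 0 := by
    intro e
    have h5 := h2 e
    simp [Prod.ext_iff] at h5
    omega
  rintro (e | e)
  · exact (h4 e).1
  · exact (h4 e).2

theorem card_strandPair (n : ℕ) : Fintype.card (StrandPair n ⊕ StrandPair n) = n * (n - 1) := by
  have h := Sym2.card_subtype_not_diag (α := Fin n)
  rw [Fintype.card_fin, Nat.choose_two_right] at h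
  rw [Fintype.card_sum, h]
  have := (Nat.even_mul_pred_self n).two_dvd
  omega

theorem nonempty_abelianization_equiv (n : ℕ) :
    Nonempty (Additive (Abelianization (SGP n)) ≃ₗ[ℤ] (Fin (n * (n - 1)) → ℤ)) := by
  -- For n < 2 there are no generators and no base pair; both sides vanish.
  rcases Nat.lt_or_ge n 2 with hn | hn
  · have hG : Subsingleton (SG n) := by
      refine subsingleton_of_forall_eq 1 fun g => ?_
      have := PresentedGroup.generated_by (relators n) ⊥ (fun x => by
        cases x with
        | σ i => exact absurd i.2 (by omega)
        | τ₁ h => omega) g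
      simpa using this
    have hA : Subsingleton (Additive (Abelianization (SGP n))) :=
      QuotientGroup.mk_surjective.subsingleton (α := SGP n)
    have hF : IsEmpty (Fin (n * (n - 1))) := by
      have : n * (n - 1) = 0 := by interval_cases n <;> rfl
      rw [this]
      infer_instance
    exact ⟨LinearEquiv.ofSubsingleton _ _⟩
  · exact ⟨((Module.Basis.mk (linearIndependent_pureClass hn) (span_pureClass hn).ge).reindex
      (Fintype.equivFinOfCardEq (card_strandPair n))).equivFun⟩

end SingularBraid

theorem mainTheorem9 (n : ℕ) :
    Nonempty (groupHomology (Rep.trivial ℤ (SingularBraid.SGP n) ℤ) 1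
      ≃ₗ[ℤ] (Fin (n * (n - 1)) → ℤ)) := by
  obtain ⟨e⟩ := SingularBraid.nonempty_abelianization_equiv n
  -- For trivial coefficients, H₁ is the abelianization tensored with the coefficients, here ℤ.
  exact ⟨(groupHomology.H1AddEquivOfIsTrivial
    (Rep.trivial ℤ (SingularBraid.SGP n) ℤ)).toIntLinearEquiv.trans
      ((TensorProduct.rid ℤ (Additive (Abelianization (SingularBraid.SGP n)))).trans e)⟩
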